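/- Let $(X,\mu)$ be a standard Borel probability space, let $(Y,p)$ be a probability space, and put $\Omega=Y^{\mathbb Z}$, $\mathbb P=p^{\mathbb Z}$, with the shift $(\theta\omega)_n=\omega_{n+1}$. Let $\bar f:\Omega\times X\to\Omega\times X$, $\bar f(\omega,x)=(\theta\omega,f_\omega(x))$, be an invertible measurable transformation with measurable inverse, where $f_\omega=f_i$ depends only on the zeroth coordinate $i=\omega_0$ of $\omega$, and suppose that $\bar\mu=\mathbb P\times\mu$ is $\bar f$-invariant and ergodic. A random $\mathrm{GL}(2)$-valued cocycle $(\bar f,A)$ over $\bar f$ is a measurable map $A:\Omega\times X\to\mathrm{GL}(2,\mathbb R)$ together with a measurable family of maps $A_i:X\to\mathrm{GL}(2,\mathbb R)$, $i\in Y$, such that $A(\omega,x)=A_{\omega_0}(x)$ for $\bar\mu$-almost every $(\omega,x)$. Two such cocycles $(\bar f,A)$ and $(\bar f,B)$ are cohomologous if there is a measurable map $P:X\to\mathrm{GL}(2,\mathbb R)$ with $B(\omega,x)=P(f_\omega(x))^{-1}A(\omega,x)P(x)$ for $\bar\mu$-almost every $(\omega,x)$. A measure $\hat\mu$ on $X\times\mathbb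 P(\mathbb R^2)$ is $(\bar f,B)$-invariant if it projects on $\mu$ and if, for $p$-almost every $i\in Y$, it is invariant under $F_i(x,z)=(f_i(x),B_i(x)z)$. **Theorem B** (in dimension $d=2$). For every random $\mathrm{GL}(2)$-valued cocycle $(\bar f,A)$ there is a random $\mathrm{GL}(2)$-valued cocycle $(\bar f,B)$ cohomologous to $(\bar f,A)$ such that every $(\bar f,B)$-invariant measure $\hat\mu$ on $X\times\mathbb P(\mathbb R^2)$ is a product measure, i.e. $\hat\mu=\mu\times\nu$ for some probability measure $\nu$ on $\mathbb P(\mathbb R^2)$. -/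

import Mathlib

open MeasureTheory
open scoped MatrixGroups LinearAlgebra.Projectivization

noncomputable section

namespace RandomCocycles

/-! ### Borel structures on `GL(d)` and on the projective space -/

/-- `GL(d, ℝ)` carries the Borel σ-algebra of its usual topology. -/
instance instMeasurableSpaceGL (d : ℕ) : MeasurableSpace (GL (Fin d) ℝ) := borel _

instance instBorelSpaceGL (d : ℕ) : BorelSpace (GL (Fin d) ℝ) := ⟨rfl⟩

/-- `ℙ(ℝᵈ)` carries the quotient topology of `ℝᵈ ∖ {0}`. -/
instance instTopologicalSpaceProj (d : ℕ) : TopologicalSpace (ℙ ℝ (Fin d → ℝ)) :=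
  inferInstanceAs (TopologicalSpace (Quotient (projectivizationSetoid ℝ (Fin d → ℝ))))

/-- `ℙ(ℝᵈ)` carries the Borel σ-algebra of the quotient topology. -/
instance instMeasurableSpaceProj (d : ℕ) : MeasurableSpace (ℙ ℝ (Fin d → ℝ)) := borel _

instance instBorelSpaceProj (d : ℕ) : BorelSpace (ℙ ℝ (Fin d → ℝ)) := ⟨rfl⟩

/-- The action of `GL(d)` on `ℙ(ℝᵈ)` (Mathlib's instance) is the usual projective action. -/
theorem smul_proj_mk {d : ℕ} (g : GL (Fin d) ℝ) (v : Fin d → ℝ) (hv : v ≠ 0) :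
    ∃ hgv : (g : Matrix (Fin d) (Fin d) ℝ).mulVec v ≠ 0,
      g • Projectivization.mk ℝ v hv =
        Projectivization.mk ℝ ((g : Matrix (Fin d) (Fin d) ℝ).mulVec v) hgv :=
  ⟨(smul_ne_zero_iff_ne g).mpr hv, rfl⟩

/-! ### Random transformations -/

variable {X Y G Z : Type*} [MeasurableSpace X] [MeasurableSpace Y]

/-- The two-sided shift on `Ω = Y^ℤ`. -/
def shift (ω : ℤ → Y) : ℤ → Y := fun n => ω (n + 1)

/-- The measure `p^ℤ × μ` on `Y^ℤ × X`. -/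
def productMeasure (p : Measure Y) (μ : Measure X) : Measure ((ℤ → Y) × X) :=
  (Measure.infinitePi fun _ : ℤ => p).prod μ

/-- A random transformation: an invertible bimeasurable skew-shift
`(ω, x) ↦ (θ ω, f_ω x)` of `Y^ℤ × X`, where `f_ω = f_i` depends only on `i = ω₀`, which preserves
`p^ℤ × μ` and is ergodic for it. -/
structure RandomTransformation (p : Measure Y) (μ : Measure X) where
  /-- the fibre maps `f_i` -/
  fiber : Y → X → X
  /-- the skew-shift -/
  skew : ((ℤ → Y) × X) ≃ᵐ ((ℤ → Y) × X)
  skew_apply : ∀ ω x, skew (ω, x) = (shift ω, fiber (ω 0) x)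
  ergodic : Ergodic skew (productMeasure p μ)

/-! ### Random cocycles, cohomology, invariant measures -/

/-- A random `G`-valued cocycle over `f`: a measurable map `A` on `Y^ℤ × X` which almost surely
depends on `(ω, x)` only through `(ω₀, x)`, i.e. `A(ω, x) = A_i(x)` with `i = ω₀`. -/
structure RandomCocycle (G : Type*) [MeasurableSpace G] {p : Measure Y} {μ : Measure X}
    (f : RandomTransformation p μ) where
  /-- the map `A` on `Y^ℤ × X` -/
  toFun : (ℤ → Y) × X → G
  measurable_toFun : Measurable toFun
  /-- the maps `A_i` on `X` -/
  fiber : Y → X → G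
  measurable_fiber : Measurable fun q : Y × X => fiber q.1 q.2
  ae_eq_fiber : ∀ᵐ z ∂(productMeasure p μ), toFun z = fiber (z.1 0) z.2

/-- Two random cocycles over `f` are cohomologous if
`B(ω, x) = P(f_ω x)⁻¹ A(ω, x) P(x)` almost surely, for a measurable `P : X → G` that does not
depend on `ω`. -/
def Cohomologous [MeasurableSpace G] [Group G] {p : Measure Y} {μ : Measure X}
    {f : RandomTransformation p μ} (A B : RandomCocycle G f) : Prop :=
  ∃ P : X → G, Measurable P ∧
    ∀ᵐ z ∂(productMeasure p μ),
      B.toFun z = (P (f.fiber (z.1 0) z.2))⁻¹ * A.toFun z * P z.2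

/-- The skew product `F_i(x, z) = (f_i x, A_i(x) z)` on `X × Z`, for a `G`-space `Z`. -/
def skewProduct [MeasurableSpace G] [Group G] [MulAction G Z] {p : Measure Y} {μ : Measure X}
    {f : RandomTransformation p μ} (A : RandomCocycle G f) (i : Y) : X × Z → X × Z :=
  fun q => (f.fiber i q.1, A.fiber i q.1 • q.2)

/-- A measure on `X × Z` is `(f, A)`-invariant if it projects on `μ` and it is `F_i`-invariant for
`p`-almost every `i`. -/
def IsInvariant [MeasurableSpace G] [Group G] [MulAction G Z] [MeasurableSpace Z]
    {p : Measure Y} {μ : Measure X} {f : RandomTransformation p μ} (A : RandomCocycle G f)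
    (m : Measure (X × Z)) : Prop :=
  m.map Prod.fst = μ ∧ ∀ᵐ i ∂p, m.map (skewProduct A i) = m

end RandomCocycles

end

/-!
Disintegrate every `(f, A)`-invariant measure over `μ`: it becomes a measurable family `x ↦ m_x` of
probability measures on `ℙ¹` with `m_{f_i x} = A_i(x)_* m_x`. If one measurable `P : X → GL(2)`
makes `P(x)⁻¹_* m_x` almost surely constant for all invariant measures at once, then the conjugate
cocycle `B = P(f x)⁻¹ A P` has only product invariant measures, since a `(f, B)`-invariant measure
is carried to an `(f, A)`-invariant one by `(x, z) ↦ (x, P(x) z)`. If there is no invariant measure,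
`B = A` works vacuously.

*Countably many measures suffice.* By separability of `L¹` there is a sequence `mⁿ` of invariant
measures such that each invariant `m` has, for almost every `x`, `m_x` as a weak limit of a
subsequence (independent of `x`) of `mⁿ_x` (`exists_seq_forall_exists_tendsto_ae`). If `P(x)⁻¹`
maps each `mⁿ_x` to a constant, the same follows for `m_x` in the limit.

*The sequences `(mⁿ_x)_n` lie in one orbit.* The set of `x` for which the `GL(2)`-orbit of
`(mⁿ_x)_n` meets a given weakly open set is invariant, so it is null or conull by ergodicity. Hence,
for almost all `x, y`, each of the two sequences lies in the closure of the orbit of the other.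
For `GL(2)` acting on sequences of probability measures on `ℙ¹` this forces the orbits to coincide
(`exists_map_smul_eq`). Indeed a sequence in `GL(2)` has a subsequence converging pointwise on `ℙ¹`
to a projective map or to a map that is constant off one point (`exists_subseq_tendsto_smul`); if
only degenerate limits occur in both directions, all the measures of each sequence live on the same
one or two points, and double transitivity of `GL(2)` on `ℙ¹` matches the two sequences.

*Choice of `P`.* The orbit map of a base point is a continuous map on the `σ`-compact group
`GL(2)`, so it has a Borel section (`exists_measurable_section`), which selects `P(x)` measurably.
-/

noncomputable section

namespace RandomCocycles

open Topology Filter Matrix ProbabilityTheory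

/-! ### The topology of the projective space -/

/-- The orthogonal projection `v vᵀ / |v|²` onto a line. It embeds the projective space into the
space of matrices, which makes its quotient topology compact metrizable. -/
def lineProj {d : ℕ} (z : ℙ ℝ (Fin d → ℝ)) : Matrix (Fin d) (Fin d) ℝ :=
  (z.rep ⬝ᵥ z.rep)⁻¹ • vecMulVec z.rep z.rep

theorem lineProj_mk {d : ℕ} (v : Fin d → ℝ) (hv : v ≠ 0) :
    lineProj (Projectivization.mk ℝ v hv) = (v ⬝ᵥ v)⁻¹ • vecMulVec v v := by
  obtain ⟨a, ha⟩ := Projectivization.exists_smul_eq_mk_rep ℝ v hv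
  have hvv : v ⬝ᵥ v ≠ 0 := by simpa [dotProduct_self_eq_zero] using hv
  have ha0 : (a : ℝ) ≠ 0 := a.ne_zero
  rw [lineProj, ← ha]
  ext i j
  simp only [Units.smul_def, smul_dotProduct, dotProduct_smul, Matrix.smul_apply, vecMulVec_apply,
    Pi.smul_apply, smul_eq_mul]
  field_simp

theorem continuous_lineProj {d : ℕ} : Continuous (lineProj (d := d)) := by
  refine (isQuotientMap_quotient_mk'
    (s := projectivizationSetoid ℝ (Fin d → ℝ))).continuous_iff.2 ?_
  have : Continuous fun v : { v : Fin d → ℝ // v ≠ 0 } => (v.1 ⬝ᵥ v.1)⁻¹ • vecMulVec v.1 v.1 := by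
    have h : Continuous fun v : { v : Fin d → ℝ // v ≠ 0 } => v.1 := continuous_subtype_val
    exact ((h.dotProduct h).inv₀ fun v => by simpa [dotProduct_self_eq_zero] using v.2).smul
      (h.matrix_vecMulVec h)
  exact this.congr fun v => (lineProj_mk v.1 v.2).symm

theorem lineProj_injective {d : ℕ} : Function.Injective (lineProj (d := d)) := by
  intro z w h
  induction z using Projectivization.ind with | h v hv =>
  induction w using Projectivization.ind with | h w hw =>
  rw [lineProj_mk, lineProj_mk] at h
  have hvv : v ⬝ᵥ v ≠ 0 := by simpa [dotProduct_self_eq_zero] using hv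
  have h2 := congrArg (fun M => M *ᵥ v) h
  simp only [smul_mulVec, vecMulVec_mulVec] at h2
  rw [Projectivization.mk_eq_mk_iff']
  refine ⟨(w ⬝ᵥ w)⁻¹ * (w ⬝ᵥ v), ?_⟩
  ext i
  have := congrFun h2 i
  simp only [Pi.smul_apply, smul_eq_mul, MulOpposite.smul_eq_mul_unop, MulOpposite.unop_op]
    at this ⊢
  field_simp at this ⊢
  linarith

instance instT2SpaceProj (d : ℕ) : T2Space (ℙ ℝ (Fin d → ℝ)) :=
  T2Space.of_injective_continuous lineProj_injective continuous_lineProj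

theorem continuous_mk {d : ℕ} {T : Type*} [TopologicalSpace T] {v : T → Fin d → ℝ}
    (hc : Continuous v) (hv : ∀ t, v t ≠ 0) :
    Continuous fun t => Projectivization.mk ℝ (v t) (hv t) :=
  (continuous_quotient_mk' (s := projectivizationSetoid ℝ (Fin d → ℝ))).comp
    (hc.subtype_mk hv)

instance instCompactSpaceProj (d : ℕ) : CompactSpace (ℙ ℝ (Fin d → ℝ)) := by
  have hne : ∀ v : Metric.sphere (0 : Fin d → ℝ) 1, v.1 ≠ 0 :=
    fun v => ne_zero_of_mem_unit_sphere v
  have hc : Continuous fun v : Metric.sphere (0 : Fin d → ℝ) 1 =>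
      Projectivization.mk ℝ v.1 (hne v) := continuous_mk continuous_subtype_val hne
  refine ⟨?_⟩
  rw [← Set.range_eq_univ.2 (?_ : Function.Surjective fun v : Metric.sphere (0 : Fin d → ℝ) 1 =>
      Projectivization.mk ℝ v.1 (hne v))]
  · exact isCompact_range hc
  · intro z
    induction z using Projectivization.ind with | h v hv =>
    refine ⟨⟨‖v‖⁻¹ • v, by simp [norm_smul, hv]⟩, ?_⟩
    rw [Projectivization.mk_eq_mk_iff']
    exact ⟨_, rfl⟩

instance instSecondCountableTopologyMatrix (m n : Type*) [Finite m] [Finite n] :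
    SecondCountableTopology (Matrix m n ℝ) :=
  inferInstanceAs (SecondCountableTopology (m → n → ℝ))

theorem isClosedEmbedding_lineProj {d : ℕ} : IsClosedEmbedding (lineProj (d := d)) :=
  continuous_lineProj.isClosedEmbedding lineProj_injective

instance instSecondCountableTopologyProj (d : ℕ) : SecondCountableTopology (ℙ ℝ (Fin d → ℝ)) :=
  isClosedEmbedding_lineProj.isEmbedding.secondCountableTopology

instance instPolishSpaceProj (d : ℕ) : PolishSpace (ℙ ℝ (Fin d → ℝ)) :=
  have : PolishSpace (Matrix (Fin d) (Fin d) ℝ) := inferInstanceAs (PolishSpace (Fin d → Fin d → ℝ))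
  isClosedEmbedding_lineProj.polishSpace

/-- In terms of projections, `g` acts by `E ↦ g E gᵀ / tr (g E gᵀ)`, which is visibly continuous in
`(g, E)`. -/
theorem lineProj_smul {d : ℕ} (g : GL (Fin d) ℝ) (z : ℙ ℝ (Fin d → ℝ)) :
    (g.1 * lineProj z * g.1ᵀ).trace ≠ 0 ∧
    lineProj (g • z) = (g.1 * lineProj z * g.1ᵀ).trace⁻¹ • (g.1 * lineProj z * g.1ᵀ) := by
  induction z using Projectivization.ind with | h v hv =>
  obtain ⟨hgv, h⟩ := smul_proj_mk g v hv
  have hvv : v ⬝ᵥ v ≠ 0 := by simpa [dotProduct_self_eq_zero] using hv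
  have hgg : (g.1 *ᵥ v) ⬝ᵥ (g.1 *ᵥ v) ≠ 0 := by simpa [dotProduct_self_eq_zero] using hgv
  rw [h, lineProj_mk, lineProj_mk]
  have : g.1 * ((v ⬝ᵥ v)⁻¹ • vecMulVec v v) * g.1ᵀ
      = (v ⬝ᵥ v)⁻¹ • vecMulVec (g.1 *ᵥ v) (g.1 *ᵥ v) := by
    rw [Matrix.mul_smul, Matrix.smul_mul, mul_vecMulVec, vecMulVec_mul, vecMul_transpose]
  rw [this, trace_smul, trace_vecMulVec]
  refine ⟨by simp [hvv, hgg], ?_⟩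
  rw [smul_smul]
  congr 1
  simp only [smul_eq_mul]
  field_simp

instance instContinuousSMulProj (d : ℕ) : ContinuousSMul (GL (Fin d) ℝ) (ℙ ℝ (Fin d → ℝ)) where
  continuous_smul := by
    rw [isClosedEmbedding_lineProj.isInducing.continuous_iff]
    have hc : Continuous fun q : GL (Fin d) ℝ × ℙ ℝ (Fin d → ℝ) =>
        q.1.1 * lineProj q.2 * q.1.1ᵀ := by
      have h1 : Continuous fun q : GL (Fin d) ℝ × ℙ ℝ (Fin d → ℝ) => q.1.1 :=
        Units.continuous_val.comp continuous_fst
      exact (h1.mul (continuous_lineProj.comp continuous_snd)).mul h1.matrix_transpose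
    refine Continuous.congr ((hc.matrix_trace.inv₀ fun q => (lineProj_smul q.1 q.2).1).smul hc) ?_
    intro q
    exact (lineProj_smul q.1 q.2).2.symm

instance instSecondCountableTopologyGL (d : ℕ) : SecondCountableTopology (GL (Fin d) ℝ) :=
  have : SecondCountableTopology (Matrix (Fin d) (Fin d) ℝ)ᵐᵒᵖ :=
    MulOpposite.opHomeomorph.symm.isEmbedding.secondCountableTopology
  Units.isEmbedding_embedProduct.secondCountableTopology

instance instSigmaCompactSpaceGL (d : ℕ) : SigmaCompactSpace (GL (Fin d) ℝ) := by
  have : LocallyCompactSpace (Matrix (Fin d) (Fin d) ℝ) :=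
    inferInstanceAs (LocallyCompactSpace (Fin d → Fin d → ℝ))
  have : LocallyCompactSpace (GL (Fin d) ℝ) := inferInstance
  infer_instance

/-- Double transitivity of `GL(d)` on the projective space. -/
theorem exists_smul_eq_of_ne {d : ℕ} {a b c e : ℙ ℝ (Fin d → ℝ)} (h : a ≠ b) (h' : c ≠ e) :
    ∃ g : GL (Fin d) ℝ, g • a = c ∧ g • b = e := by
  obtain ⟨g, h1, h2⟩ := (MulAction.is_two_pretransitive_iff (G := SL(d, ℝ))
    (α := ℙ ℝ (Fin d → ℝ))).1 inferInstance h h'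
  exact ⟨g, h1, h2⟩

theorem exists_smul_proj_eq (a c : ℙ ℝ (Fin 2 → ℝ)) : ∃ g : GL (Fin 2) ℝ, g • a = c := by
  have : MulAction.IsPretransitive SL(2, ℝ) (ℙ ℝ (Fin 2 → ℝ)) := inferInstance
  obtain ⟨g, h⟩ := MulAction.exists_smul_eq SL(2, ℝ) a c
  exact ⟨g, h⟩

/-! ### Limits of projective maps -/

section Degeneration

theorem tendsto_mk {d : ℕ} {ι : Type*} {l : Filter ι} {u : ι → Fin d → ℝ} {v : Fin d → ℝ}
    (h : Tendsto u l (𝓝 v)) (hu : ∀ k, u k ≠ 0) (hv : v ≠ 0) :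
    Tendsto (fun k => Projectivization.mk ℝ (u k) (hu k)) l (𝓝 (Projectivization.mk ℝ v hv)) :=
  ((continuous_quotient_mk' (s := projectivizationSetoid ℝ (Fin d → ℝ))).tendsto ⟨v, hv⟩).comp
    (tendsto_subtype_rng.2 h : Tendsto (fun k => (⟨u k, hu k⟩ : { v : Fin d → ℝ // v ≠ 0 })) l _)

theorem exists_combination_of_mk_ne {u v : Fin 2 → ℝ} (hu : u ≠ 0) (hv : v ≠ 0)
    (h : Projectivization.mk ℝ v hv ≠ Projectivization.mk ℝ u hu) (w : Fin 2 → ℝ) :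
    ∃ a b : ℝ, w = a • u + b • v := by
  have hD : u 0 * v 1 - u 1 * v 0 ≠ 0 := by
    intro hD
    apply h
    rw [Projectivization.mk_eq_mk_iff']
    by_cases h0 : u 0 = 0
    · have h1 : u 1 ≠ 0 := fun h1 => hu (by ext i; fin_cases i <;> simp [h0, h1])
      refine ⟨v 1 / u 1, ?_⟩
      ext i
      fin_cases i <;> simp <;> field_simp
      linarith
    · refine ⟨v 0 / u 0, ?_⟩
      ext i
      fin_cases i <;> simp <;> field_simp
      linarith
  refine ⟨(w 0 * v 1 - w 1 * v 0) / (u 0 * v 1 - u 1 * v 0),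
    (u 0 * w 1 - u 1 * w 0) / (u 0 * v 1 - u 1 * v 0), ?_⟩
  ext i
  fin_cases i <;> simp only [Fin.zero_eta, Fin.mk_one, Pi.add_apply, Pi.smul_apply, smul_eq_mul] <;>
    rw [div_mul_eq_mul_div, div_mul_eq_mul_div, ← add_div, eq_div_iff hD] <;> ring

attribute [local instance] Matrix.normedAddCommGroup Matrix.normedSpace

/-- If rescaled matrices `c_k g_k` converge to `M`, possibly singular, then `g_k` converges to the
projective map of `M` at every line outside `ker M`. -/
theorem tendsto_smul_mk {g : ℕ → GL (Fin 2) ℝ} {c : ℕ → ℝ} (hc : ∀ k, c k ≠ 0)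
    {M : Matrix (Fin 2) (Fin 2) ℝ} (h : Tendsto (fun k => c k • (g k).1) atTop (𝓝 M))
    {v : Fin 2 → ℝ} (hv : v ≠ 0) (hMv : M *ᵥ v ≠ 0) :
    Tendsto (fun k => g k • Projectivization.mk ℝ v hv) atTop
      (𝓝 (Projectivization.mk ℝ (M *ᵥ v) hMv)) := by
  have hgv : ∀ k, (c k • (g k).1) *ᵥ v ≠ 0 := fun k => by
    rw [smul_mulVec]
    exact smul_ne_zero (hc k) (smul_proj_mk (g k) v hv).1
  have hlim : Tendsto (fun k => (c k • (g k).1) *ᵥ v) atTop (𝓝 (M *ᵥ v)) :=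
    ((continuous_id.matrix_mulVec continuous_const).tendsto M).comp h
  refine (tendsto_mk hlim hgv hMv).congr fun k => ?_
  obtain ⟨hk, e⟩ := smul_proj_mk (g k) v hv
  rw [e, Projectivization.mk_eq_mk_iff']
  exact ⟨c k, (smul_mulVec _ _ _).symm⟩

open Classical in
/-- Every sequence in `GL(2)` has a subsequence converging pointwise on `ℙ¹`, either to the action
of an element of `GL(2)` or to a map that is constant off one point. In the second case the point
`κ` is the kernel, and the constant `ι` the range, of a rank one limit of the normalized
matrices. -/
theorem exists_subseq_tendsto_smul (g : ℕ → GL (Fin 2) ℝ) :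
    ∃ (φ : ℕ → ℕ) (ψ : ℙ ℝ (Fin 2 → ℝ) → ℙ ℝ (Fin 2 → ℝ)), StrictMono φ ∧
      (∀ z, Tendsto (fun k => g (φ k) • z) atTop (𝓝 (ψ z))) ∧
      ((∃ h : GL (Fin 2) ℝ, ψ = fun z => h • z) ∨
        ∃ κ τ ι, ψ = fun z => if z = κ then τ else ι) := by
  have hg0 : ∀ k, (g k).1 ≠ 0 := fun k => (g k).ne_zero
  have : ProperSpace (Matrix (Fin 2) (Fin 2) ℝ) := inferInstanceAs (ProperSpace (Fin 2 → Fin 2 → ℝ))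
  obtain ⟨M, hM, φ, hφ, hlim⟩ := (isCompact_sphere (0 : Matrix (Fin 2) (Fin 2) ℝ) 1).tendsto_subseq
    (x := fun k => ‖(g k).1‖⁻¹ • (g k).1) (fun k => by
      have := norm_ne_zero_iff.2 (hg0 k)
      simp [norm_smul, this])
  have hM0 : M ≠ 0 := ne_zero_of_mem_unit_sphere ⟨M, hM⟩
  have hc : ∀ k, ‖(g (φ k)).1‖⁻¹ ≠ 0 := fun k => inv_ne_zero (norm_ne_zero_iff.2 (hg0 _))
  by_cases hdet : M.det = 0
  · obtain ⟨u, hu, hMu⟩ := exists_mulVec_eq_zero_iff.2 hdet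
    obtain ⟨w, hMw⟩ : ∃ w, M *ᵥ w ≠ 0 := by
      by_contra! H
      exact hM0 (Matrix.ext_of_mulVec_single fun i => by rw [H, zero_mulVec])
    obtain ⟨τ, χ, hχ, hτ⟩ := CompactSpace.tendsto_subseq
      (fun k => g (φ k) • Projectivization.mk ℝ u hu)
    refine ⟨φ ∘ χ, fun z => if z = Projectivization.mk ℝ u hu then τ else
      Projectivization.mk ℝ (M *ᵥ w) hMw, hφ.comp hχ, fun z => ?_, Or.inr ⟨_, _, _, rfl⟩⟩
    beta_reduce
    split_ifs with hz
    · rw [hz]; exact hτ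
    · induction z using Projectivization.ind with | h v hv =>
      obtain ⟨a, b, hab⟩ := exists_combination_of_mk_ne hu hv hz w
      have hMwv : M *ᵥ w = b • M *ᵥ v := by
        rw [hab, mulVec_add, mulVec_smul, mulVec_smul, hMu, smul_zero, zero_add]
      have hMv : M *ᵥ v ≠ 0 := fun h => hMw (by rw [hMwv, h, smul_zero])
      have e : Projectivization.mk ℝ (M *ᵥ w) hMw = Projectivization.mk ℝ (M *ᵥ v) hMv := by
        rw [Projectivization.mk_eq_mk_iff']
        exact ⟨b, hMwv.symm⟩
      rw [e]
      exact (tendsto_smul_mk hc hlim hv hMv).comp hχ.tendsto_atTop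
  · refine ⟨φ, _, hφ, fun z => ?_, Or.inl ⟨GeneralLinearGroup.mkOfDetNeZero M hdet, rfl⟩⟩
    induction z using Projectivization.ind with | h v hv =>
    obtain ⟨hMv, e⟩ := smul_proj_mk (GeneralLinearGroup.mkOfDetNeZero M hdet) v hv
    simp only [e]
    exact tendsto_smul_mk hc hlim hv hMv

end Degeneration

/-! ### Weak convergence tested on a dense family -/

section Integral
variable {Z : Type*} [TopologicalSpace Z] [CompactSpace Z] [MeasurableSpace Z] [BorelSpace Z]

theorem integrable_continuousMap (φ : C(Z, ℝ)) (m : Measure Z) [IsFiniteMeasure m] :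
    Integrable φ m :=
  (BoundedContinuousFunction.mkOfCompact φ).integrable m

/-- Weak convergence of probability measures on a compact space may be tested on a dense family. -/
theorem tendsto_integral_of_denseRange {ι κ : Type*} {l : Filter ι} {Φ : κ → C(Z, ℝ)}
    (hΦ : DenseRange Φ) {m : ι → Measure Z} {m' : Measure Z} [∀ k, IsProbabilityMeasure (m k)]
    [IsProbabilityMeasure m']
    (h : ∀ j, Tendsto (fun k => ∫ z, Φ j z ∂m k) l (𝓝 (∫ z, Φ j z ∂m'))) (φ : C(Z, ℝ)) :
    Tendsto (fun k => ∫ z, φ z ∂m k) l (𝓝 (∫ z, φ z ∂m')) := by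
  have key : ∀ (ν : Measure Z) [IsProbabilityMeasure ν] (j : κ),
      dist (∫ z, φ z ∂ν) (∫ z, Φ j z ∂ν) ≤ dist φ (Φ j) := by
    intro ν _ j
    rw [dist_eq_norm, ← integral_sub (integrable_continuousMap _ _) (integrable_continuousMap _ _)]
    refine (norm_integral_le_of_norm_le_const (C := dist φ (Φ j)) (ae_of_all _ fun z => ?_)).trans
      (by simp)
    rw [← dist_eq_norm]
    exact ContinuousMap.dist_apply_le_dist z
  rw [Metric.tendsto_nhds]
  intro ε hε
  obtain ⟨j, hj⟩ := hΦ.exists_dist_lt φ (ε := ε / 3) (by positivity)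
  filter_upwards [Metric.tendsto_nhds.1 (h j) (ε / 3) (by positivity)] with k hk
  have h1 := key (m k) j
  have h2 := key m' j
  rw [dist_comm] at h2
  have := dist_triangle4 (∫ z, φ z ∂m k) (∫ z, Φ j z ∂m k) (∫ z, Φ j z ∂m') (∫ z, φ z ∂m')
  linarith

theorem ext_of_integral_eq_of_denseRange [HasOuterApproxClosed Z] {κ : Type*} {Φ : κ → C(Z, ℝ)}
    (hΦ : DenseRange Φ) {m m' : Measure Z} [IsProbabilityMeasure m] [IsProbabilityMeasure m']
    (h : ∀ j, ∫ z, Φ j z ∂m = ∫ z, Φ j z ∂m') : m = m' := by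
  refine ext_of_forall_integral_eq_of_IsFiniteMeasure fun φ => ?_
  have := tendsto_integral_of_denseRange (l := (atTop : Filter ℕ)) (m := fun _ => m) (m' := m') hΦ
    (fun j => by simp [h j]) φ.toContinuousMap
  exact tendsto_nhds_unique tendsto_const_nhds this
end Integral

/-! ### Orbits of sequences of measures on the projective line -/

/-- The quotient of the space of sequences of probability measures on `ℙ¹` by `GL(2)` is a T0
space: if each of two sequences lies in the closure of the orbit of the other, they are in the
same orbit. Membership in the closure is expressed through integrals of the dense family `Φ`. -/
theorem exists_map_smul_eq {v w : ℕ → Measure (ℙ ℝ (Fin 2 → ℝ))}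
    [∀ n, IsProbabilityMeasure (v n)] [∀ n, IsProbabilityMeasure (w n)]
    {κ : Type*} {Φ : κ → C(ℙ ℝ (Fin 2 → ℝ), ℝ)} (hΦ : DenseRange Φ) {g h : ℕ → GL (Fin 2) ℝ}
    (hg : ∀ n j, Tendsto (fun k => ∫ z, Φ j (g k • z) ∂v n) atTop (𝓝 (∫ z, Φ j z ∂w n)))
    (hh : ∀ n j, Tendsto (fun k => ∫ z, Φ j (h k • z) ∂w n) atTop (𝓝 (∫ z, Φ j z ∂v n))) :
    ∃ a : GL (Fin 2) ℝ, ∀ n, w n = (v n).map (a • ·) := by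
  classical
  -- Pass to the pointwise limit `ψ` of a subsequence: by dominated convergence `w n = ψ_* (v n)`.
  have key : ∀ (v w : ℕ → Measure (ℙ ℝ (Fin 2 → ℝ))) [∀ n, IsProbabilityMeasure (v n)]
      [∀ n, IsProbabilityMeasure (w n)] (g : ℕ → GL (Fin 2) ℝ),
      (∀ n j, Tendsto (fun k => ∫ z, Φ j (g k • z) ∂v n) atTop (𝓝 (∫ z, Φ j z ∂w n))) →
      (∃ a : GL (Fin 2) ℝ, ∀ n, w n = (v n).map (a • ·)) ∨
        ∃ κ τ ι, ∀ n, w n = (v n).map fun z => if z = κ then τ else ι := by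
    intro v w _ _ g hg
    obtain ⟨φ, ψ, hφ, hlim, hψ⟩ := exists_subseq_tendsto_smul g
    have hmeas : Measurable ψ := by
      rcases hψ with ⟨a, rfl⟩ | ⟨κ, τ, ι, rfl⟩
      · exact measurable_const_smul a
      · exact Measurable.ite (measurableSet_singleton κ) measurable_const measurable_const
    have hw : ∀ n, w n = (v n).map ψ := by
      intro n
      have := Measure.isProbabilityMeasure_map (μ := v n) hmeas.aemeasurable
      refine ext_of_integral_eq_of_denseRange hΦ fun j => ?_
      rw [integral_map hmeas.aemeasurable (Φ j).continuous.aestronglyMeasurable]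
      refine tendsto_nhds_unique ((hg n j).comp hφ.tendsto_atTop) ?_
      refine tendsto_integral_of_dominated_convergence (fun _ => ‖Φ j‖) (fun k => ?_)
        (integrable_const _) (fun k => ae_of_all _ fun z => (Φ j).norm_coe_le_norm _)
        (ae_of_all _ fun z => ((Φ j).continuous.tendsto _).comp (hlim z))
      exact ((Φ j).continuous.comp (continuous_const_smul _)).aestronglyMeasurable
    rcases hψ with ⟨a, rfl⟩ | ⟨κ, τ, ι, rfl⟩
    · exact Or.inl ⟨a, hw⟩
    · exact Or.inr ⟨κ, τ, ι, hw⟩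
  rcases key v w g hg with H | ⟨κ, τ, ι, hw⟩
  · exact H
  rcases key w v h hh with ⟨a, ha⟩ | ⟨κ', τ', ι', hv⟩
  · refine ⟨a⁻¹, fun n => ?_⟩
    rw [ha n, Measure.map_map (measurable_const_smul _) (measurable_const_smul _)]
    simp [Function.comp_def]
  have hm : ∀ κ τ ι : ℙ ℝ (Fin 2 → ℝ), Measurable fun z => if z = κ then τ else ι := fun κ τ ι =>
    Measurable.ite (measurableSet_singleton κ) measurable_const measurable_const
  -- Both limits `ψ` (from `v` to `w`) and `χ` (back) are degenerate. Then `v n = (χ ∘ ψ)_* (v n)`,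
  -- where `χ ∘ ψ` takes a value `s` at `κ` and a value `t` elsewhere. If `s ≠ t`, double transitivity
  -- gives `a` with `a ∘ χ ∘ ψ = ψ`, which maps `v n` to `ψ_* (v n) = w n`.
  have hvv : ∀ n, v n = (v n).map fun z => if z = κ then (if τ = κ' then τ' else ι')
      else (if ι = κ' then τ' else ι') := by
    intro n
    conv_lhs => rw [hv n, hw n, Measure.map_map (hm _ _ _) (hm _ _ _)]
    congr 1
    ext z
    simp only [Function.comp]
    split_ifs <;> rfl
  have hτι : τ = ι → (if τ = κ' then τ' else ι') = (if ι = κ' then τ' else ι') := fun e => by rw [e]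
  generalize (if τ = κ' then τ' else ι') = s at hvv hτι
  generalize (if ι = κ' then τ' else ι') = t at hvv hτι
  by_cases hst : s = t
  -- Here every `v n` is the Dirac mass at `s`, and every `w n` the one at `ψ s`.
  · subst hst
    obtain ⟨a, ha⟩ := exists_smul_proj_eq s (if s = κ then τ else ι)
    refine ⟨a, fun n => ?_⟩
    have hd : v n = Measure.dirac s := by rw [hvv n]; simp [Measure.map_const]
    rw [hw n, hd, Measure.map_dirac' (hm _ _ _), Measure.map_dirac' (measurable_const_smul _), ha]
  · obtain ⟨a, ha1, ha2⟩ := exists_smul_eq_of_ne hst fun e => hst (hτι e)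
    refine ⟨a, fun n => ?_⟩
    rw [hvv n, Measure.map_map (measurable_const_smul _) (hm _ _ _), hw n]
    congr 1
    ext z
    simp only [Function.comp]
    split_ifs <;> simp [*]

/-! ### Borel sections of continuous maps -/

section Section
variable {W : Type*} [TopologicalSpace W] [T2Space W] [MeasurableSpace W] [OpensMeasurableSpace W]

/-- A continuous map on the Cantor set has a Borel section, the least point of each fibre: its
sublevel sets are, on the range, images of compact sets. -/
theorem exists_measurable_section_cantorSet {q : cantorSet → W} (hq : Continuous q) :
    ∃ s : W → cantorSet, Measurable s ∧ ∀ w ∈ Set.range q, q (s w) = w := by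
  have : CompactSpace cantorSet := isCompact_iff_compactSpace.1 isCompact_cantorSet
  have hpos : ∀ t : cantorSet, (0 : ℝ) ≤ t := fun t => (cantorSet_subset_unitInterval t.2).1
  have hmin : ∀ w, ∃ t : cantorSet, (w ∈ Set.range q → q t = w ∧ ∀ t', q t' = w → t ≤ t') ∧
      (w ∉ Set.range q → (t : ℝ) = 0) := by
    intro w
    by_cases hw : w ∈ Set.range q
    · obtain ⟨t, ht⟩ := hw
      have hc : IsCompact (q ⁻¹' {w}) := (isClosed_singleton.preimage hq).isCompact
      obtain ⟨t₀, h1, h2⟩ := hc.exists_isLeast ⟨t, ht⟩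
      exact ⟨t₀, fun _ => ⟨h1, fun t' ht' => h2 ht'⟩, fun h => absurd ⟨t, ht⟩ h⟩
    · exact ⟨⟨0, zero_mem_cantorSet⟩, fun h => absurd h hw, fun _ => rfl⟩
  choose s hs hs₀ using hmin
  refine ⟨s, ?_, fun w hw => (hs w hw).1⟩
  suffices h : Measurable fun w => (s w : ℝ) from h.subtype_mk (h := fun w => (s w).2)
  refine measurable_of_Iic fun a => ?_
  have : (fun w => (s w : ℝ)) ⁻¹' Set.Iic a =
      q '' {t | (t : ℝ) ≤ a} ∪ ((Set.range q)ᶜ ∩ {_w | 0 ≤ a}) := by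
    ext w
    simp only [Set.mem_preimage, Set.mem_Iic, Set.mem_union, Set.mem_image, Set.mem_ofPred_eq,
      Set.mem_inter_iff, Set.mem_compl_iff]
    by_cases hw : w ∈ Set.range q
    · simp only [hw, not_true_eq_false, false_and, or_false]
      exact ⟨fun h => ⟨s w, h, (hs w hw).1⟩, fun ⟨t, ht, htw⟩ =>
        le_trans ((hs w hw).2 t htw) ht⟩
    · simp only [hs₀ w hw, hw, not_false_eq_true, true_and]
      exact ⟨Or.inr, fun h => h.elim (fun ⟨t, _, ht⟩ => absurd ⟨t, ht⟩ hw) id⟩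
  rw [this]
  have hcl : IsClosed {t : cantorSet | (t : ℝ) ≤ a} :=
    isClosed_Iic.preimage continuous_subtype_val
  exact (hcl.isCompact.image hq).measurableSet.union
    ((isCompact_range hq).measurableSet.compl.inter (MeasurableSet.const _))

/-- A continuous map on a `σ`-compact metrizable space has a Borel section: parametrize each compact
piece by the Cantor set. -/
theorem exists_measurable_section {G : Type*} [TopologicalSpace G]
    [TopologicalSpace.MetrizableSpace G] [SigmaCompactSpace G] [Nonempty G]
    [MeasurableSpace G] [BorelSpace G] {q : G → W}
    (hq : Continuous q) : ∃ s : W → G, Measurable s ∧ ∀ w ∈ Set.range q, q (s w) = w := by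
  let _ := TopologicalSpace.metrizableSpaceMetric G
  obtain ⟨g₀⟩ := ‹Nonempty G›
  have hK : ∀ n, ∃ s : W → G, Measurable s ∧ ∀ w ∈ q '' compactCovering G n, q (s w) = w := by
    intro n
    have hc : IsCompact (insert g₀ (compactCovering G n)) :=
      (isCompact_compactCovering G n).insert g₀
    have := isCompact_iff_compactSpace.1 hc
    have : Nonempty ↑(insert g₀ (compactCovering G n)) := ⟨⟨g₀, Set.mem_insert _ _⟩⟩
    obtain ⟨c, hc, hsurj⟩ :=
      exists_nat_bool_continuous_surjective_of_compact ↑(insert g₀ (compactCovering G n))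
    have hc' : Continuous fun t : cantorSet => (c (cantorSetHomeomorphNatToBool t) : G) :=
      continuous_subtype_val.comp (hc.comp cantorSetHomeomorphNatToBool.continuous)
    obtain ⟨s, hs, hs'⟩ := exists_measurable_section_cantorSet (hq.comp hc')
    refine ⟨_, hc'.measurable.comp hs, ?_⟩
    rintro w ⟨g, hg, rfl⟩
    obtain ⟨b, hb⟩ := hsurj ⟨g, Set.mem_insert_of_mem _ hg⟩
    exact hs' _ ⟨cantorSetHomeomorphNatToBool.symm b, by simp [hb]⟩
  choose s hs hs' using hK
  have hm : ∀ n, MeasurableSet (q '' compactCovering G n) := fun n =>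
    ((isCompact_compactCovering G n).image hq).measurableSet
  obtain ⟨f, hf, hf'⟩ := exists_measurable_piecewise (disjointed fun n => q '' compactCovering G n)
    (MeasurableSet.disjointed hm) s hs
    (fun i j hij => by
      beta_reduce
      rw [Set.disjoint_iff_inter_eq_empty.1 (disjoint_disjointed _ hij)]
      exact Set.eqOn_empty _ _)
  refine ⟨f, hf, ?_⟩
  rintro w ⟨g, rfl⟩
  have : q g ∈ ⋃ n, disjointed (fun n => q '' compactCovering G n) n := by
    rw [iUnion_disjointed]
    obtain ⟨n, hn⟩ := exists_mem_compactCovering g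
    exact Set.mem_iUnion.2 ⟨n, g, hn, rfl⟩
  obtain ⟨n, hn⟩ := Set.mem_iUnion.1 this
  rw [hf' n hn]
  exact hs' n _ (disjointed_subset _ n hn)
end Section

/-! ### Fibre maps and the zero-one law -/

section Transformation
variable {X Y : Type*} [MeasurableSpace X] [MeasurableSpace Y] {p : Measure Y} {μ : Measure X}

theorem RandomTransformation.measurable_fiber (f : RandomTransformation p μ) :
    Measurable fun q : Y × X => f.fiber q.1 q.2 := by
  have h : Measurable fun q : Y × X => (f.skew (fun _ => q.1, q.2)).2 :=
    (f.skew.measurable.comp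
      ((measurable_pi_lambda _ fun _ => measurable_fst).prodMk measurable_snd)).snd
  simpa only [f.skew_apply] using h

/-- Each fibre map is invertible: restrict the skew-shift to the constant sequence. -/
def RandomTransformation.fiberEquiv (f : RandomTransformation p μ) (i : Y) : X ≃ᵐ X where
  toFun := f.fiber i
  invFun x := (f.skew.symm (fun _ => i, x)).2
  left_inv x := by
    have h : f.skew (fun _ => i, x) = (fun _ => i, f.fiber i x) := f.skew_apply _ _
    beta_reduce
    rw [← h, f.skew.symm_apply_apply]
  right_inv x := by
    obtain ⟨⟨ω, y⟩, h⟩ := f.skew.surjective (fun _ => i, x)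
    beta_reduce
    rw [← h, f.skew.symm_apply_apply]
    rw [f.skew_apply, Prod.mk.injEq] at h
    -- The shift of `ω` is constant equal to `i`, and `ω 0` is its value at `-1`.
    have h0 : ω 0 = i := by simpa [shift] using congrFun h.1 (-1)
    rw [← h0]
    exact h.2
  measurable_toFun := f.measurable_fiber.comp measurable_prodMk_left
  measurable_invFun := (f.skew.symm.measurable.comp measurable_prodMk_left).snd

/-- A property of `(i, x)` that holds almost surely holds almost surely at `(ω₀, x)`. -/
theorem ae_productMeasure_of_ae_ae [IsProbabilityMeasure p] [SFinite μ] {s : Set (Y × X)}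
    (hs : MeasurableSet s) (h : ∀ᵐ i ∂p, ∀ᵐ x ∂μ, (i, x) ∈ s) :
    ∀ᵐ z ∂productMeasure p μ, (z.1 0, z.2) ∈ s := by
  have h1 : ∀ᵐ q ∂p.prod μ, q ∈ s := (Measure.ae_prod_mem_iff_ae_ae_mem hs).2 h
  have h2 : MeasurePreserving (Prod.map (fun ω : ℤ → Y => ω 0) id)
      (productMeasure p μ) (p.prod μ) :=
    (measurePreserving_eval_infinitePi (fun _ : ℤ => p) 0).prod (MeasurePreserving.id μ)
  exact h2.quasiMeasurePreserving.ae h1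

/-- Ergodicity of the skew-shift yields a zero-one law for subsets of `X` that are invariant modulo
null sets under almost every fibre map. -/
theorem RandomTransformation.ae_mem_or_ae_notMem [IsProbabilityMeasure p] [IsProbabilityMeasure μ]
    (f : RandomTransformation p μ) {E : Set X} (hE : MeasurableSet E)
    (h : ∀ᵐ i ∂p, ∀ᵐ x ∂μ, f.fiber i x ∈ E ↔ x ∈ E) :
    (∀ᵐ x ∂μ, x ∈ E) ∨ ∀ᵐ x ∂μ, x ∉ E := by
  have hs : MeasurableSet {q : Y × X | f.fiber q.1 q.2 ∈ E ↔ q.2 ∈ E} :=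
    MeasurableSet.iff (f.measurable_fiber hE) (measurable_snd hE)
  have h1 := ae_productMeasure_of_ae_ae hs h
  have hinv : f.skew ⁻¹' (Set.univ ×ˢ E) =ᵐ[productMeasure p μ] (Set.univ ×ˢ E) := by
    filter_upwards [h1] with z hz
    have : (f.skew z ∈ Set.univ ×ˢ E) = (z ∈ (Set.univ : Set (ℤ → Y)) ×ˢ E) := by
      obtain ⟨ω, x⟩ := z
      rw [f.skew_apply]
      simpa using hz
    exact this
  have hsnd : MeasurePreserving Prod.snd (productMeasure p μ) μ := measurePreserving_snd
  rcases f.ergodic.quasiErgodic.ae_empty_or_univ₀ (MeasurableSet.univ.prod hE).nullMeasurableSet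
    hinv with h2 | h2
  · right
    rw [← hsnd.map_eq]
    refine (ae_map_iff (p := fun x => x ∉ E) hsnd.measurable.aemeasurable hE.compl).2 ?_
    filter_upwards [eventuallyEq_empty.1 h2] with z hz hzE using hz ⟨trivial, hzE⟩
  · left
    rw [← hsnd.map_eq]
    refine (ae_map_iff (p := fun x => x ∈ E) hsnd.measurable.aemeasurable hE).2 ?_
    filter_upwards [eventuallyEq_univ.1 h2] with z hz using hz.2
end Transformation

/-! ### Disintegration of invariant measures -/

section Disintegration
variable {X G Z : Type*} [MeasurableSpace X] [MeasurableSpace G] [Group G] [MulAction G Z]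
  [MeasurableSpace Z] [MeasurableSMul₂ G Z] [StandardBorelSpace Z] [Nonempty Z]

/-- Invariance of `m` under `(x, z) ↦ (T x, a(x) z)` is equivariance of its disintegration. -/
theorem condKernel_ae_eq_map_smul {μ : Measure X} {T : X ≃ᵐ X} {a : X → G} (ha : Measurable a)
    {m : Measure (X × Z)} [IsFiniteMeasure m] (hm : m.fst = μ)
    (hT : m.map (fun q => (T q.1, a q.1 • q.2)) = m) :
    ∀ᵐ x ∂μ, m.condKernel (T x) = (m.condKernel x).map (a x • ·) := by
  subst hm
  have hF : Measurable fun q : X × Z => (T q.1, a q.1 • q.2) :=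
    (T.measurable.comp measurable_fst).prodMk ((ha.comp measurable_fst).smul measurable_snd)
  have hTm : MeasurePreserving T m.fst m.fst := by
    refine ⟨T.measurable, ?_⟩
    conv_rhs => rw [← hT]
    rw [Measure.fst, Measure.fst, Measure.map_map measurable_fst hF,
      Measure.map_map T.measurable measurable_fst]
    rfl
  have hsm : Measurable fun q : X × Z => a q.1 • q.2 := (ha.comp measurable_fst).smul measurable_snd
  let κ₀ : Kernel X Z := (Kernel.id ×ₖ m.condKernel).map fun q => a q.1 • q.2
  have hκ₀ : ∀ x, κ₀ x = (m.condKernel x).map (a x • ·) := by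
    intro x
    rw [Kernel.map_apply _ hsm, Kernel.prod_apply, Kernel.id_apply, Measure.dirac_prod,
      Measure.map_map hsm measurable_prodMk_left]
    rfl
  have : IsMarkovKernel κ₀ := Kernel.IsMarkovKernel.map _ hsm
  let κ : Kernel X Z := κ₀.comap T.symm T.symm.measurable
  have hκ : ∀ x, κ (T x) = κ₀ x := fun x => by simp [κ]
  have hcomp : m = m.fst ⊗ₘ κ := by
    ext s hs
    conv_lhs => rw [← hT, Measure.map_apply hF hs, ← m.disintegrate m.condKernel,
      Measure.compProd_apply (hF hs)]
    rw [Measure.compProd_apply hs, ← hTm.lintegral_comp (Kernel.measurable_kernel_prodMk_left hs)]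
    refine lintegral_congr fun x => ?_
    rw [hκ, hκ₀, Measure.map_apply (measurable_const_smul _) (measurable_prodMk_left hs)]
    rfl
  filter_upwards [hTm.quasiMeasurePreserving.ae (eq_condKernel_of_measure_eq_compProd κ hcomp)]
    with x hx
  rw [← hx, hκ, hκ₀]
end Disintegration

/-! ### Separability in almost sure convergence -/

/-- A family of bounded measurable maps `X → ℝ^ℕ` contains a countable subfamily such that every
member is the almost sure limit of a sequence taken from it. -/
theorem exists_seq_forall_exists_tendsto_ae {X ι : Type*} [MeasurableSpace X]
    [MeasurableSpace.CountablyGenerated X] [Nonempty ι] (μ : Measure X) [IsFiniteMeasure μ]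
    {ψ : ι → ℕ → X → ℝ} (hψ : ∀ i j, Measurable (ψ i j)) {C : ℕ → ℝ}
    (hC : ∀ i j x, |ψ i j x| ≤ C j) :
    ∃ u : ℕ → ι, ∀ i, ∃ a : ℕ → ℕ, ∀ᵐ x ∂μ, ∀ j,
      Tendsto (fun k => ψ (u (a k)) j x) atTop (𝓝 (ψ i j x)) := by
  -- Almost sure convergence of all coordinates at once is almost sure convergence on `X × ℕ`; the
  -- counting measure is replaced by an equivalent finite one, and the coordinates are normalized to
  -- be bounded by `1`, so that the functions lie in `L¹`.
  let c : Measure ℕ := Measure.count.toFinite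
  have hpos : ∀ j, 0 < 1 + |C j| := fun j => by positivity
  have hmem : ∀ i, MemLp (fun q : X × ℕ => ψ i q.2 q.1 / (1 + |C q.2|)) 1 (μ.prod c) := by
    intro i
    refine MemLp.of_bound (C := 1) ?_ (ae_of_all _ fun q => ?_)
    · refine Measurable.aestronglyMeasurable (measurable_from_prod_countable_left fun j => ?_)
      exact (hψ i j).div_const (1 + |C j|)
    · rw [Real.norm_eq_abs, abs_div, abs_of_pos (hpos _), div_le_one (hpos _)]
      have := hC i q.2 q.1
      have := le_abs_self (C q.2)
      linarith
  let F : ι → Lp ℝ 1 (μ.prod c) := fun i => (hmem i).toLp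
  have : Fact ((1 : ENNReal) ≠ ⊤) := ⟨ENNReal.one_ne_top⟩
  have hF : ∃ u : ℕ → ι, ∀ i, F i ∈ closure (Set.range (F ∘ u)) := by
    choose u hu using fun n => (TopologicalSpace.denseSeq (Set.range F) n).2
    refine ⟨u, fun i => ?_⟩
    have h2 := TopologicalSpace.denseRange_denseSeq (Set.range F) ⟨F i, i, rfl⟩
    rw [closure_subtype, ← Set.range_comp] at h2
    convert h2 using 3
    ext n
    simp [hu]
  obtain ⟨u, hu⟩ := hF
  refine ⟨u, fun i => ?_⟩
  obtain ⟨y, hy, hlim⟩ := mem_closure_iff_seq_limit.1 (hu i)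
  choose a ha using hy
  have hlim' : Tendsto (fun k => F (u (a k))) atTop (𝓝 (F i)) :=
    hlim.congr fun k => (ha k).symm
  obtain ⟨b, -, hb⟩ := (tendstoInMeasure_of_tendsto_Lp hlim').exists_seq_tendsto_ae
  refine ⟨a ∘ b, ?_⟩
  have hco : ∀ᵐ q ∂μ.prod c, ∀ l : ι, l ∈ Set.range u ∪ {i} →
      F l q = ψ l q.2 q.1 / (1 + |C q.2|) := by
    refine (ae_ball_iff ((Set.countable_range u).union (Set.countable_singleton i))).2 fun l _ => ?_
    exact (hmem l).coeFn_toLp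
  have hae : ∀ᵐ q ∂μ.prod c,
      Tendsto (fun k => ψ (u (a (b k))) q.2 q.1) atTop (𝓝 (ψ i q.2 q.1)) := by
    filter_upwards [hb, hco] with q h1 h2
    rw [h2 i (Or.inr rfl)] at h1
    have h3 := (h1.congr fun k => h2 _ (Or.inl ⟨_, rfl⟩)).mul_const (1 + |C q.2|)
    simpa only [div_mul_cancel₀ _ (hpos q.2).ne'] using h3
  filter_upwards [Measure.ae_ae_of_ae_prod hae] with x hx
  rw [ae_toFinite, Measure.ae_count_iff] at hx
  exact hx

/-! ### Reduction to a single orbit -/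

section SingleOrbit
variable {X Y : Type*} [MeasurableSpace X] [MeasurableSpace Y] {p : Measure Y} {μ : Measure X}

theorem integral_smul_map_smul (φ : C(ℙ ℝ (Fin 2 → ℝ), ℝ)) (g h : GL (Fin 2) ℝ)
    (m : Measure (ℙ ℝ (Fin 2 → ℝ))) :
    ∫ z, φ (g • z) ∂m.map (h • ·) = ∫ z, φ ((g * h) • z) ∂m := by
  have hc : Continuous fun z => φ (g • z) := φ.continuous.comp (continuous_const_smul g)
  rw [integral_map (measurable_const_smul h).aemeasurable hc.aestronglyMeasurable]
  simp only [mul_smul]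

/-- A sequence of equivariant families of measures `κ n x` takes values, almost surely, in a single
`GL(2)`-orbit, and the transporting element can be chosen measurably. All `κ n` are straightened by
the same `P`. -/
theorem exists_map_smul_eq_of_equivariant [IsProbabilityMeasure p] [IsProbabilityMeasure μ]
    (f : RandomTransformation p μ) (a : Y → X → GL (Fin 2) ℝ)
    (κ : ℕ → Kernel X (ℙ ℝ (Fin 2 → ℝ))) [∀ n, IsMarkovKernel (κ n)]
    (hκ : ∀ᵐ i ∂p, ∀ᵐ x ∂μ, ∀ n, κ n (f.fiber i x) = (κ n x).map (a i x • ·)) :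
    ∃ (P : X → GL (Fin 2) ℝ) (ν : ℕ → Measure (ℙ ℝ (Fin 2 → ℝ))), Measurable P ∧
      ∀ᵐ x ∂μ, ∀ n, κ n x = (ν n).map (P x • ·) := by
  let Φ : ℕ → C(ℙ ℝ (Fin 2 → ℝ), ℝ) := TopologicalSpace.denseSeq _
  have hΦ : DenseRange Φ := TopologicalSpace.denseRange_denseSeq _
  -- `R g x` lists the integrals that determine the sequence `g_* (κ n x)`, and `E U` is the set of
  -- points `x` whose orbit meets `U`.
  let R : GL (Fin 2) ℝ → X → ℕ → ℕ → ℝ := fun g x n j => ∫ z, Φ j (g • z) ∂κ n x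
  have hRc : ∀ x, Continuous fun g => R g x := by
    refine fun x => continuous_pi fun n => continuous_pi fun j => ?_
    refine continuous_of_dominated (bound := fun _ => ‖Φ j‖) (fun g => ?_)
      (fun g => ae_of_all _ fun z => (Φ j).norm_coe_le_norm _) (integrable_const _)
      (ae_of_all _ fun z => ?_)
    · exact ((Φ j).continuous.comp (continuous_const_smul g)).aestronglyMeasurable
    · exact (Φ j).continuous.comp (continuous_id.smul continuous_const)
  have hRm : ∀ g, Measurable (R g) := by
    refine fun g => measurable_pi_lambda _ fun n => measurable_pi_lambda _ fun j => ?_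
    have : StronglyMeasurable fun z => Φ j (g • z) :=
      ((Φ j).continuous.comp (continuous_const_smul g)).stronglyMeasurable
    exact (this.integral_kernel (κ := κ n)).measurable
  let E : Set (ℕ → ℕ → ℝ) → Set X := fun U => {x | ∃ g, R g x ∈ U}
  have hEm : ∀ U, IsOpen U → MeasurableSet (E U) := by
    intro U hU
    -- By continuity in `g`, a countable dense set of `g` suffices.
    have : E U = ⋃ k, R (TopologicalSpace.denseSeq (GL (Fin 2) ℝ) k) ⁻¹' U := by
      ext x
      simp only [Set.mem_iUnion, Set.mem_preimage]
      constructor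
      · rintro ⟨g, hg⟩
        exact (TopologicalSpace.denseRange_denseSeq (GL (Fin 2) ℝ)).exists_mem_open
          (hU.preimage (hRc x)) ⟨g, hg⟩
      · rintro ⟨k, hk⟩
        exact ⟨_, hk⟩
    rw [this]
    exact MeasurableSet.iUnion fun k => hRm _ hU.measurableSet
  have hEinv : ∀ U, ∀ᵐ i ∂p, ∀ᵐ x ∂μ, f.fiber i x ∈ E U ↔ x ∈ E U := by
    intro U
    filter_upwards [hκ] with i hi
    filter_upwards [hi] with x hx
    have hR : ∀ g, R g (f.fiber i x) = R (g * a i x) x := by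
      intro g
      ext n j
      simp only [R]
      rw [hx n, integral_smul_map_smul]
    constructor
    · rintro ⟨g, hg⟩
      exact ⟨g * a i x, hR g ▸ hg⟩
    · rintro ⟨g, hg⟩
      refine ⟨g * (a i x)⁻¹, ?_⟩
      rw [hR, inv_mul_cancel_right]
      exact hg
  have hgood : ∀ᵐ x ∂μ, ∀ U ∈ TopologicalSpace.countableBasis (ℕ → ℕ → ℝ),
      (x ∈ E U ↔ ∀ᵐ y ∂μ, y ∈ E U) := by
    refine (ae_ball_iff (TopologicalSpace.countable_countableBasis _)).2 fun U hU => ?_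
    rcases f.ae_mem_or_ae_notMem (hEm U (TopologicalSpace.isOpen_of_mem_countableBasis hU))
      (hEinv U) with h | h
    · filter_upwards [h] with x hx
      exact iff_of_true hx h
    · filter_upwards [h] with x hx
      refine iff_of_false hx fun h' => ?_
      obtain ⟨y, hy, hy'⟩ := (h.and h').exists
      exact hy hy'
  have hclos : ∀ x y, (∀ U ∈ TopologicalSpace.countableBasis (ℕ → ℕ → ℝ), y ∈ E U → x ∈ E U) →
      ∃ g : ℕ → GL (Fin 2) ℝ, ∀ n j, Tendsto (fun k => ∫ z, Φ j (g k • z) ∂κ n x) atTop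
        (𝓝 (∫ z, Φ j z ∂κ n y)) := by
    intro x y h
    have : R 1 y ∈ closure (Set.range fun g => R g x) := by
      refine (TopologicalSpace.isBasis_countableBasis _).mem_closure_iff.2 fun U hU hy => ?_
      obtain ⟨g, hg⟩ := h U hU ⟨1, hy⟩
      exact ⟨_, hg, g, rfl⟩
    obtain ⟨r, hr, hlim⟩ := mem_closure_iff_seq_limit.1 this
    choose g hg using hr
    refine ⟨g, fun n j => ?_⟩
    have h2 := (tendsto_pi_nhds.1 (tendsto_pi_nhds.1 hlim n) j)
    simp only [← hg, R, one_smul] at h2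
    exact h2
  obtain ⟨x₀, hx₀⟩ := hgood.exists
  obtain ⟨s, hs, hs'⟩ := exists_measurable_section (hRc x₀)
  refine ⟨fun x => s (R 1 x), fun n => κ n x₀, hs.comp (hRm 1), ?_⟩
  filter_upwards [hgood] with x hx n
  obtain ⟨g, hg⟩ := hclos x₀ x fun U hU h => (hx₀ U hU).2 ((hx U hU).1 h)
  obtain ⟨h, hh⟩ := hclos x x₀ fun U hU h => (hx U hU).2 ((hx₀ U hU).1 h)
  obtain ⟨b, hb⟩ := exists_map_smul_eq (v := fun n => κ n x₀) (w := fun n => κ n x) hΦ hg hh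
  have hRb : R b x₀ = R 1 x := by
    ext n j
    simp only [R]
    rw [hb n, integral_smul_map_smul, one_mul]
  have hsec := hs' _ ⟨b, hRb⟩
  have := Measure.isProbabilityMeasure_map (μ := κ n x₀)
    (measurable_const_smul (s (R 1 x))).aemeasurable
  refine ext_of_integral_eq_of_denseRange hΦ fun j => ?_
  rw [integral_map (measurable_const_smul _).aemeasurable
        (Φ j).continuous.aestronglyMeasurable]
  have := congrFun (congrFun hsec n) j
  simpa only [R, one_smul] using this.symm
end SingleOrbit

/-! ### Conjugate cocycles and their invariant measures -/

section Conjugation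
variable {X Y : Type*} [MeasurableSpace X] [MeasurableSpace Y] {p : Measure Y} {μ : Measure X}
  {f : RandomTransformation p μ}

/-- The cocycle `P(f_ω x)⁻¹ A(ω, x) P(x)`; the same formula defines its fibres `B_i` for every
`i` and every `x`. -/
def RandomCocycle.conj {d : ℕ} (A : RandomCocycle (GL (Fin d) ℝ) f) {P : X → GL (Fin d) ℝ}
    (hP : Measurable P) : RandomCocycle (GL (Fin d) ℝ) f where
  toFun z := (P (f.fiber (z.1 0) z.2))⁻¹ * A.toFun z * P z.2
  measurable_toFun := by
    have h : Measurable fun z : (ℤ → Y) × X => f.fiber (z.1 0) z.2 :=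
      f.measurable_fiber.comp (f := fun z : (ℤ → Y) × X => (z.1 0, z.2))
        (((measurable_pi_apply 0).comp measurable_fst).prodMk measurable_snd)
    exact ((hP.comp h).inv.mul A.measurable_toFun).mul (hP.comp measurable_snd)
  fiber i x := (P (f.fiber i x))⁻¹ * A.fiber i x * P x
  measurable_fiber :=
    ((hP.comp f.measurable_fiber).inv.mul A.measurable_fiber).mul (hP.comp measurable_snd)
  ae_eq_fiber := by
    filter_upwards [A.ae_eq_fiber] with z hz
    rw [hz]

theorem cohomologous_conj {d : ℕ} (A : RandomCocycle (GL (Fin d) ℝ) f) {P : X → GL (Fin d) ℝ}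
    (hP : Measurable P) : Cohomologous A (A.conj hP) :=
  ⟨P, hP, ae_of_all _ fun _ => rfl⟩

theorem measurable_shear {d : ℕ} {P : X → GL (Fin d) ℝ} (hP : Measurable P) :
    Measurable fun q : X × ℙ ℝ (Fin d → ℝ) => (q.1, P q.1 • q.2) :=
  measurable_fst.prodMk ((hP.comp measurable_fst).smul measurable_snd)

theorem measurable_skewProduct {d : ℕ} (A : RandomCocycle (GL (Fin d) ℝ) f) (i : Y) :
    Measurable (skewProduct (Z := ℙ ℝ (Fin d → ℝ)) A i) :=
  ((f.measurable_fiber.comp measurable_prodMk_left).comp measurable_fst).prodMk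
    (((A.measurable_fiber.comp measurable_prodMk_left).comp measurable_fst).smul measurable_snd)

/-- The shear `(x, z) ↦ (x, P(x) z)` carries invariant measures of the conjugate cocycle to
invariant measures of the original one. -/
theorem IsInvariant.map_shear {d : ℕ} {A : RandomCocycle (GL (Fin d) ℝ) f}
    {P : X → GL (Fin d) ℝ} (hP : Measurable P) {m : Measure (X × ℙ ℝ (Fin d → ℝ))}
    (hm : IsInvariant (A.conj hP) m) :
    IsInvariant A (m.map fun q => (q.1, P q.1 • q.2)) := by
  refine ⟨?_, ?_⟩
  · rw [Measure.map_map measurable_fst (measurable_shear hP)]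
    exact hm.1
  · filter_upwards [hm.2] with i hi
    conv_rhs => rw [← hi]
    rw [Measure.map_map (measurable_skewProduct A i) (measurable_shear hP),
      Measure.map_map (measurable_shear hP) (measurable_skewProduct _ i)]
    congr 1
    ext1 q
    simp [skewProduct, RandomCocycle.conj, mul_smul]

theorem IsInvariant.isProbabilityMeasure [IsProbabilityMeasure μ] {d : ℕ}
    {A : RandomCocycle (GL (Fin d) ℝ) f} {m : Measure (X × ℙ ℝ (Fin d → ℝ))}
    (hm : IsInvariant A m) : IsProbabilityMeasure m := by
  have h : IsProbabilityMeasure (m.map Prod.fst) := hm.1 ▸ inferInstance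
  exact Measure.isProbabilityMeasure_of_map (f := Prod.fst)

theorem IsInvariant.condKernel_ae_eq [IsProbabilityMeasure μ]
    {A : RandomCocycle (GL (Fin 2) ℝ) f} {m : Measure (X × ℙ ℝ (Fin 2 → ℝ))} [IsFiniteMeasure m]
    (hm : IsInvariant A m) : ∀ᵐ i ∂p, ∀ᵐ x ∂μ,
      m.condKernel (f.fiber i x) = (m.condKernel x).map (A.fiber i x • ·) := by
  filter_upwards [hm.2] with i hi
  exact condKernel_ae_eq_map_smul (T := f.fiberEquiv i)
    (A.measurable_fiber.comp measurable_prodMk_left) hm.1 hi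

/-- If the disintegration of the sheared measure is almost surely `P(x)_* ν`, then the measure is
`μ × ν`. -/
theorem eq_prod_of_condKernel_map_shear {P : X → GL (Fin 2) ℝ} (hP : Measurable P)
    {m : Measure (X × ℙ ℝ (Fin 2 → ℝ))} [IsFiniteMeasure m] (hm : m.fst = μ)
    {ν : Measure (ℙ ℝ (Fin 2 → ℝ))} [SFinite ν]
    (h : ∀ᵐ x ∂μ, ((m.map fun q => (q.1, P q.1 • q.2)).condKernel x).map ((P x)⁻¹ • ·) = ν) :
    m = μ.prod ν := by
  have hs := measurable_shear hP
  have hs' : Measurable fun q : X × ℙ ℝ (Fin 2 → ℝ) => (q.1, (P q.1)⁻¹ • q.2) :=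
    measurable_shear hP.inv
  set m' := m.map fun q => (q.1, P q.1 • q.2) with hm'
  have hfst : m'.fst = μ := by
    rw [Measure.fst, hm', Measure.map_map measurable_fst hs]
    exact hm
  have hback : m = m'.map fun q => (q.1, (P q.1)⁻¹ • q.2) := by
    rw [hm', Measure.map_map hs' hs]
    simp [Function.comp_def]
  subst hfst
  ext s hsm
  rw [hback, Measure.map_apply hs' hsm]
  conv_lhs => rw [← m'.disintegrate m'.condKernel]
  rw [Measure.compProd_apply (hs' hsm), Measure.prod_apply hsm]
  refine lintegral_congr_ae ?_
  filter_upwards [h] with x hx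
  rw [← hx, Measure.map_apply (measurable_const_smul _) (measurable_prodMk_left hsm)]
  rfl
end Conjugation

end RandomCocycles

end

open RandomCocycles ProbabilityTheory Filter Topology in
theorem theoremB {X Y : Type*} [MeasurableSpace X] [StandardBorelSpace X] [MeasurableSpace Y]
    (μ : Measure X) [IsProbabilityMeasure μ] (p : Measure Y) [IsProbabilityMeasure p]
    (f : RandomCocycles.RandomTransformation p μ)
    (A : RandomCocycles.RandomCocycle (GL (Fin 2) ℝ) f) :
    ∃ B : RandomCocycles.RandomCocycle (GL (Fin 2) ℝ) f,
      RandomCocycles.Cohomologous A B ∧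
        ∀ m : Measure (X × ℙ ℝ (Fin 2 → ℝ)), RandomCocycles.IsInvariant B m →
          ∃ ν : Measure (ℙ ℝ (Fin 2 → ℝ)), IsProbabilityMeasure ν ∧ m = μ.prod ν := by
  by_cases hex : ∃ m : Measure (X × ℙ ℝ (Fin 2 → ℝ)), IsInvariant A m
  swap
  · exact ⟨A, ⟨fun _ => 1, measurable_const, ae_of_all _ fun z => by simp⟩,
      fun m hm => absurd ⟨m, hm⟩ hex⟩
  let I := {m : Measure (X × ℙ ℝ (Fin 2 → ℝ)) // IsInvariant A m}
  have : Nonempty I := let ⟨m, hm⟩ := hex; ⟨⟨m, hm⟩⟩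
  have hI : ∀ m : I, IsProbabilityMeasure m.1 := fun m => m.2.isProbabilityMeasure
  let Φ : ℕ → C(ℙ ℝ (Fin 2 → ℝ), ℝ) := TopologicalSpace.denseSeq _
  have hΦ : DenseRange Φ := TopologicalSpace.denseRange_denseSeq _
  obtain ⟨u, hu⟩ := exists_seq_forall_exists_tendsto_ae μ
    (ψ := fun (m : I) j x => ∫ z, Φ j z ∂m.1.condKernel x) (C := fun j => ‖Φ j‖)
    (fun m j => ((Φ j).continuous.stronglyMeasurable.integral_kernel
      (κ := m.1.condKernel)).measurable)
    (fun m j x => (norm_integral_le_of_norm_le_const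
      (ae_of_all _ fun z => (Φ j).norm_coe_le_norm z)).trans (by simp))
  obtain ⟨P, η, hP, hη⟩ := exists_map_smul_eq_of_equivariant f A.fiber
    (fun n => (u n).1.condKernel) (by
      filter_upwards [ae_all_iff.2 fun n => (u n).2.condKernel_ae_eq] with i hi
      exact ae_all_iff.2 hi)
  refine ⟨A.conj hP, cohomologous_conj A hP, fun m hm => ?_⟩
  have := hm.isProbabilityMeasure
  let m' : I := ⟨_, hm.map_shear hP⟩
  obtain ⟨a, ha⟩ := hu m'
  let ν : X → Measure (ℙ ℝ (Fin 2 → ℝ)) := fun x => (m'.1.condKernel x).map ((P x)⁻¹ • ·)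
  have hν : ∀ x, IsProbabilityMeasure (ν x) := fun x =>
    Measure.isProbabilityMeasure_map (measurable_const_smul _).aemeasurable
  -- `P(x)⁻¹` maps the approximating measures to the constants `η (a k)`, so the straightened
  -- disintegration `ν x` is the weak limit of a sequence that does not depend on `x`.
  have hlim : ∀ᵐ x ∂μ, ∀ φ : C(ℙ ℝ (Fin 2 → ℝ), ℝ),
      Tendsto (fun k => ∫ z, φ z ∂η (a k)) atTop (𝓝 (∫ z, φ z ∂ν x)) := by
    filter_upwards [ha, hη] with x hx hxη φ
    have h := tendsto_integral_of_denseRange hΦ hx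
      (φ.comp ⟨fun z => (P x)⁻¹ • z, continuous_const_smul _⟩)
    simp only [ContinuousMap.comp_apply, ContinuousMap.coe_mk, hxη, integral_smul_map_smul,
      inv_mul_cancel, one_smul] at h
    simp only [ν]
    rwa [integral_map (measurable_const_smul _).aemeasurable φ.continuous.aestronglyMeasurable]
  obtain ⟨x₀, hx₀⟩ := hlim.exists
  refine ⟨ν x₀, hν x₀, eq_prod_of_condKernel_map_shear hP hm.1 ?_⟩
  filter_upwards [hlim] with x hx
  exact ext_of_integral_eq_of_denseRange hΦ fun j =>
    tendsto_nhds_unique (hx (Φ j)) (hx₀ (Φ j))
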